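/- Let $\Gamma=(V,E)$ be a finite simple graph with adjacency matrix $A$. Call $\Gamma$ *strongly walk-regular* if for some integer $\ell\ge 2$ the power $A^\ell$ is a linear combination of $I$, $A$ and the all-ones matrix $J$, and *genuine* strongly walk-regular if, moreover, $\Gamma$ is connected and $A$ has exactly four distinct eigenvalues (such a graph is regular, and its largest eigenvalue $k$ is its valency). Let $\mathcal A=\{(x,y)\in V\times V : \{x,y\}\in E\}$ be the set of arcs; for $a=(x,y)$ put $o(a)=x$, $t(a)=y$ and $a^{-1}=(y,x)$. Let $d\in\mathbb C^{V\times\mathcal A}$ with $d_{x,a}=\frac{1}{\sqrt{\deg x}}\,\delta_{x,t(a)}$, let $R\in\mathbb C^{\mathcal A\times\mathcal A}$ with $R_{a,b}=\delta_{a,b^{-1}}$, and let $U=R(2d^*d-I)$ be the time evolution matrix of the Grover walk on $\Gamma$. The graph $\Gamma$ is *periodic* if $U^\tau=I$ for some integer $\tau\ge 1$. **Corollary.** Let $\Gamma$ be a genuine strongly walk-regular graph with distinct eigenvalues $k>\theta_1>\theta_2>\theta_3$. Then $\Gamma$ is periodic if and only if $(\theta_1,\theta_2,\theta_3)=\left(\frac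 k2,0,-\frac k2\right)$. In that case, $U^{12}=I$. -/

import Mathlib

open scoped Matrix

namespace GroverWalk

noncomputable section

variable {V : Type*} [Fintype V] [DecidableEq V]

/-- The boundary matrix `d ∈ ℂ^(V × 𝒜)`, `d_{x,a} = δ_{x,t(a)} / √(deg x)`. The symmetric arcs of `G`
are its darts; a dart `a` has origin `a.fst`, terminus `a.snd` and inverse `a.symm`. -/
def boundary (G : SimpleGraph V) [DecidableRel G.Adj] : Matrix V G.Dart ℂ :=
  Matrix.of fun x a => if x = a.snd then (1 / Real.sqrt (G.degree x) : ℂ) else 0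

/-- The shift matrix `R ∈ ℂ^(𝒜 × 𝒜)`, `R_{a,b} = δ_{a,b⁻¹}`. -/
def shift (G : SimpleGraph V) : Matrix G.Dart G.Dart ℂ :=
  Matrix.of fun a b => if a = b.symm then 1 else 0

/-- The time evolution matrix `U = R (2 d* d - I)` of the Grover walk on `G`. -/
def timeEvolution (G : SimpleGraph V) [DecidableRel G.Adj] : Matrix G.Dart G.Dart ℂ :=
  shift G * ((2 : ℂ) • ((boundary G)ᴴ * boundary G) - 1)

/-- `G` is periodic: `U ^ τ = I` for some positive integer `τ`. -/
def IsPeriodic (G : SimpleGraph V) [DecidableRel G.Adj] : Prop :=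
  ∃ τ : ℕ, 1 ≤ τ ∧ timeEvolution G ^ τ = 1

/-- `G` is strongly `ℓ`-walk-regular, for `ℓ ≥ 2`: the power `A ^ ℓ` of the adjacency matrix is a
linear combination of `I`, `A` and the all-ones matrix `J`. -/
def IsStronglyWalkRegularOfLength (G : SimpleGraph V) [DecidableRel G.Adj] (ℓ : ℕ) : Prop :=
  2 ≤ ℓ ∧ ∃ a b c : ℝ, G.adjMatrix ℝ ^ ℓ =
    a • (1 : Matrix V V ℝ) + b • G.adjMatrix ℝ + c • Matrix.of fun _ _ => (1 : ℝ)

/-- `G` is strongly walk-regular: strongly `ℓ`-walk-regular for some `ℓ ≥ 2`. -/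
def IsStronglyWalkRegular (G : SimpleGraph V) [DecidableRel G.Adj] : Prop :=
  ∃ ℓ : ℕ, IsStronglyWalkRegularOfLength G ℓ

/-- `G` is a genuine strongly walk-regular graph: a connected strongly walk-regular graph whose
adjacency matrix has exactly four distinct eigenvalues. -/
structure IsGenuineStronglyWalkRegular (G : SimpleGraph V) [DecidableRel G.Adj] : Prop where
  connected : G.Connected
  stronglyWalkRegular : IsStronglyWalkRegular G
  four_eigenvalues : (spectrum ℝ (G.adjMatrix ℝ)).ncard = 4

end

end GroverWalk

/-! Write `d`, `R` for the boundary and shift matrices and `D` for the valency. Then `d d* = I` and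
`d R d* = A / D`, so an eigenvector `v` of `A / D` for `μ` gives `f = d* v`, `g = R d* v` with `U f
= g` and `U g = 2μ g - f`. The walk thus acts through the roots of `z² - 2μ z + 1`.

Periodicity makes these roots roots of unity, so each `2θ / D` is an algebraic integer
(`isIntegral_of_periodic`). The three scaled eigenvalues `x₁ > x₂ > x₃` in `[-2, 2)` have rational,
hence integral, elementary symmetric functions. By strong walk-regularity they are also roots of one
trinomial `x ^ ℓ = b x + a`. Convexity forces `ℓ` to be odd and controls the sign of `x₁ + x₂ + x₃`;
integrality then forces the sum to vanish (`sum_eq_zero_of_roots`). Only finitely many cubics `x³ -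
q x - r` remain (`coeff_cases`), and the traces of `A` and `A²` eliminate all but `x³ - x`
(`cubic_coeffs_of_traces`).

Conversely, `μ = 1, 1/2, 0, -1/2` give roots of unity of orders 1, 6, 4, 3, with least common
multiple 12. So `U ^ 12` fixes the ranges of `d*` and `R d*`; these contain the range of `U² - 1`,
and unitarity of `U` finishes the argument (`timeEvolution_pow_twelve`). -/

open scoped ComplexOrder

namespace GroverWalk

/-! ### The Grover walk and the transition matrix -/

section Walk

variable {V : Type*} [Fintype V] [DecidableEq V] {G : SimpleGraph V} [DecidableRel G.Adj]

omit [DecidableEq V] in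
theorem sum_dart {M : Type*} [AddCommMonoid M] (F : V → V → M) :
    ∑ a : G.Dart, F a.fst a.snd = ∑ x, ∑ y, if G.Adj x y then F x y else 0 := by
  let e : {p : V × V // G.Adj p.1 p.2} ≃ G.Dart :=
    ⟨fun p => ⟨p.1, p.2⟩, fun a => ⟨a.toProd, a.adj⟩, fun _ => rfl, fun _ => rfl⟩
  rw [← e.sum_comp, ← Fintype.sum_prod_type', ← Finset.sum_filter]
  exact (Finset.sum_subtype (Finset.univ.filter fun p : V × V => G.Adj p.1 p.2) (by simp)
    (fun p => F p.1 p.2)).symm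

theorem shift_mul_apply {ι : Type*} (M : Matrix G.Dart ι ℂ) (a : G.Dart) (i : ι) :
    (shift G * M) a i = M a.symm i := by
  have h : ∀ b : G.Dart, a = b.symm ↔ a.symm = b := fun b =>
    ⟨fun h => by rw [h, SimpleGraph.Dart.symm_symm], fun h => by rw [← h, SimpleGraph.Dart.symm_symm]⟩
  simp [Matrix.mul_apply, shift, h]

theorem shift_mul_shift : shift G * shift G = 1 := by
  ext a b
  rw [shift_mul_apply]
  simp [shift, Matrix.one_apply, SimpleGraph.Dart.symm_involutive.injective.eq_iff]

omit [Fintype V] [DecidableRel G.Adj] in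
theorem conjTranspose_shift : (shift G)ᴴ = shift G := by
  have h : ∀ a b : G.Dart, a = b.symm ↔ b = a.symm := fun a b =>
    ⟨fun h => by rw [h, SimpleGraph.Dart.symm_symm], fun h => by rw [h, SimpleGraph.Dart.symm_symm]⟩
  ext a b
  simp only [Matrix.conjTranspose_apply, shift, Matrix.of_apply, h b a]
  split_ifs <;> simp

theorem sqrt_cast_inv_mul_self (D : ℕ) :
    ((Real.sqrt D : ℝ) : ℂ)⁻¹ * ((Real.sqrt D : ℝ) : ℂ)⁻¹ = (D : ℂ)⁻¹ := by
  rw [← mul_inv, ← Complex.ofReal_mul, Real.mul_self_sqrt (Nat.cast_nonneg D)]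
  simp

theorem boundary_mul_conjTranspose {D : ℕ} (hreg : G.IsRegularOfDegree D) (hD : 0 < D) :
    boundary G * (boundary G)ᴴ = 1 := by
  ext x y
  have h : (boundary G * (boundary G)ᴴ) x y = ∑ a : G.Dart,
      if x = a.snd then (if y = a.snd then (D : ℂ)⁻¹ else 0) else 0 := by
    rw [Matrix.mul_apply]
    refine Finset.sum_congr rfl fun a _ => ?_
    simp only [boundary, Matrix.conjTranspose_apply, Matrix.of_apply, hreg.degree_eq]
    split_ifs <;> simp [sqrt_cast_inv_mul_self]
  refine h.trans ((sum_dart fun _ s =>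
    if x = s then (if y = s then (D : ℂ)⁻¹ else 0) else 0).trans ?_)
  have hD' : (D : ℂ) ≠ 0 := by exact_mod_cast hD.ne'
  have h2 : ∀ z w : V, (if G.Adj z w then (if x = w then (if y = w then (D : ℂ)⁻¹ else 0) else 0)
      else 0) = if x = w then (if G.Adj z x then (if y = x then (D : ℂ)⁻¹ else 0) else 0) else 0 := by
    intro z w
    by_cases hxw : x = w
    · subst hxw; simp
    · simp [hxw]
  simp only [h2, Finset.sum_ite_eq, Finset.mem_univ, if_true]
  by_cases hxy : y = x
  · subst hxy
    have : (Finset.univ.filter fun z => G.Adj z y).card = D := by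
      rw [← hreg.degree_eq y, ← SimpleGraph.card_neighborFinset_eq_degree]
      congr 1
      ext z
      simp [G.adj_comm]
    simp [← Finset.sum_filter, this, hD']
  · simp [hxy, Matrix.one_apply_ne (Ne.symm hxy)]

theorem boundary_mul_shift_mul_conjTranspose {D : ℕ} (hreg : G.IsRegularOfDegree D) :
    boundary G * (shift G * (boundary G)ᴴ) = (D : ℂ)⁻¹ • G.adjMatrix ℂ := by
  ext x y
  have h : (boundary G * (shift G * (boundary G)ᴴ)) x y = ∑ a : G.Dart,
      if x = a.snd then (if y = a.fst then (D : ℂ)⁻¹ else 0) else 0 := by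
    rw [Matrix.mul_apply]
    refine Finset.sum_congr rfl fun a _ => ?_
    rw [shift_mul_apply]
    simp only [boundary, Matrix.conjTranspose_apply, Matrix.of_apply, hreg.degree_eq]
    change _ * star (if y = a.fst then (1 / Real.sqrt D : ℂ) else 0) = _
    split_ifs <;> simp [sqrt_cast_inv_mul_self]
  refine h.trans ((sum_dart fun r s =>
    if x = s then (if y = r then (D : ℂ)⁻¹ else 0) else 0).trans ?_)
  have h2 : ∀ z w : V, (if G.Adj z w then (if x = w then (if y = z then (D : ℂ)⁻¹ else 0) else 0)
      else 0) = if x = w then (if y = z then (if G.Adj y x then (D : ℂ)⁻¹ else 0) else 0) else 0 := by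
    intro z w
    by_cases hxw : x = w
    · subst hxw
      by_cases hyz : y = z
      · subst hyz; simp
      · simp [hyz]
    · simp [hxw]
  simp [h2, SimpleGraph.adjMatrix_apply, G.adj_comm]

theorem timeEvolution_eq :
    timeEvolution G = (2 : ℂ) • (shift G * (boundary G)ᴴ * boundary G) - shift G := by
  simp [timeEvolution, mul_sub, Matrix.mul_assoc]

theorem timeEvolution_mul_conjTranspose_boundary {D : ℕ} (hreg : G.IsRegularOfDegree D)
    (hD : 0 < D) : timeEvolution G * (boundary G)ᴴ = shift G * (boundary G)ᴴ := by
  rw [timeEvolution_eq, Matrix.sub_mul, Matrix.smul_mul, Matrix.mul_assoc _ (boundary G),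
    boundary_mul_conjTranspose hreg hD, Matrix.mul_one, two_smul, add_sub_cancel_right]

theorem timeEvolution_mul_shift_mul_conjTranspose {D : ℕ} (hreg : G.IsRegularOfDegree D) :
    timeEvolution G * (shift G * (boundary G)ᴴ) =
      (2 : ℂ) • (shift G * (boundary G)ᴴ * ((D : ℂ)⁻¹ • G.adjMatrix ℂ)) - (boundary G)ᴴ := by
  rw [timeEvolution_eq, Matrix.sub_mul, Matrix.smul_mul, Matrix.mul_assoc _ (boundary G),
    boundary_mul_shift_mul_conjTranspose hreg, ← Matrix.mul_assoc (shift G) (shift G),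
    shift_mul_shift, Matrix.one_mul]

theorem timeEvolution_mul_conjTranspose {D : ℕ} (hreg : G.IsRegularOfDegree D) (hD : 0 < D) :
    timeEvolution G * (timeEvolution G)ᴴ = 1 := by
  set P := (boundary G)ᴴ * boundary G with hP
  have hPP : P * P = P := by
    rw [hP, Matrix.mul_assoc, ← Matrix.mul_assoc (boundary G),
      boundary_mul_conjTranspose hreg hD, Matrix.one_mul]
  have hPh : Pᴴ = P := by rw [hP]; simp
  have hQ : ((2 : ℂ) • P - 1) * ((2 : ℂ) • P - 1) = 1 := by
    simp only [mul_sub, sub_mul, Matrix.smul_mul, Matrix.mul_smul, hPP, mul_one, one_mul]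
    module
  have hQh : ((2 : ℂ) • P - 1)ᴴ = (2 : ℂ) • P - 1 := by
    simp [Matrix.conjTranspose_sub, Matrix.conjTranspose_smul, hPh]
  rw [timeEvolution, ← hP, Matrix.conjTranspose_mul, conjTranspose_shift, hQh, Matrix.mul_assoc,
    ← Matrix.mul_assoc _ _ (shift G), hQ, Matrix.one_mul, shift_mul_shift]

/-- For an eigenvalue `μ` of the transition matrix `A / D`, the number `2 μ` is a sum `z + z⁻¹` with
`z` an eigenvalue of the time evolution matrix. -/
theorem isIntegral_of_periodic {D : ℕ} (hreg : G.IsRegularOfDegree D) (hD : 0 < D)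
    (hper : IsPeriodic G) {μ : ℂ} {v : V → ℂ} (hv : v ≠ 0)
    (hμ : ((D : ℂ)⁻¹ • G.adjMatrix ℂ) *ᵥ v = μ • v) : IsIntegral ℤ (2 * μ) := by
  obtain ⟨τ, hτ, hU⟩ := hper
  have hpow : ∀ (z : ℂ) (w : G.Dart → ℂ), w ≠ 0 → timeEvolution G *ᵥ w = z • w → z ^ τ = 1 := by
    intro z w hw h
    have h1 : ∀ n : ℕ, (timeEvolution G ^ n) *ᵥ w = z ^ n • w := by
      intro n
      induction n with
      | zero => simp
      | succ n ih =>
        rw [pow_succ, ← Matrix.mulVec_mulVec, h, Matrix.mulVec_smul, ih, smul_smul, pow_succ,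
          mul_comm]
    have h2 := h1 τ
    rw [hU, Matrix.one_mulVec] at h2
    by_contra hne
    have h3 : (z ^ τ - 1) • w = 0 := by rw [sub_smul, one_smul, ← h2, sub_self]
    exact (smul_eq_zero.mp h3).elim (fun h => hne (sub_eq_zero.mp h)) hw
  set f := (boundary G)ᴴ *ᵥ v with hf
  set g := (shift G * (boundary G)ᴴ) *ᵥ v with hg
  have hUf : timeEvolution G *ᵥ f = g := by
    rw [hf, hg, Matrix.mulVec_mulVec, timeEvolution_mul_conjTranspose_boundary hreg hD]
  have hUg : timeEvolution G *ᵥ g = (2 * μ) • g - f := by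
    rw [hf, hg, Matrix.mulVec_mulVec, timeEvolution_mul_shift_mul_conjTranspose hreg,
      Matrix.sub_mulVec, Matrix.smul_mulVec, ← Matrix.mulVec_mulVec, hμ, Matrix.mulVec_smul,
      smul_smul]
  have hf0 : f ≠ 0 := by
    intro h0
    apply hv
    have : boundary G *ᵥ f = v := by
      rw [hf, Matrix.mulVec_mulVec, boundary_mul_conjTranspose hreg hD, Matrix.one_mulVec]
    rw [← this, h0, Matrix.mulVec_zero]
  -- `μ ± s` are the two roots of `z² - 2μ z + 1`.
  obtain ⟨s, hs⟩ := IsAlgClosed.exists_pow_nat_eq (μ ^ 2 - 1) (n := 2) (by norm_num)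
  have hz : (μ + s) * (μ - s) = 1 := by linear_combination -hs
  have hroot : ∀ z : ℂ, z ^ τ = 1 → IsIntegral ℤ z := fun z h =>
    IsIntegral.of_pow (n := τ) (by omega) (h ▸ isIntegral_one)
  have hpair : (μ + s) ^ τ = 1 := by
    -- The vector `g - (μ - s) f` is an eigenvector for `μ + s` unless it vanishes; in that case `f`
    -- is one for `μ - s`. Either way both roots are roots of unity, being mutually inverse.
    by_cases hh : g - (μ - s) • f = 0
    · have h1 : timeEvolution G *ᵥ f = (μ - s) • f := by rw [hUf, sub_eq_zero.mp hh]
      have h2 := hpow _ _ hf0 h1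
      have h3 := congrArg (· ^ τ) hz
      simpa [mul_pow, h2] using h3
    · refine hpow _ _ hh ?_
      rw [Matrix.mulVec_sub, Matrix.mulVec_smul, hUf, hUg, smul_sub, smul_smul, hz]
      module
  have hpair2 : (μ - s) ^ τ = 1 := by
    have h3 := congrArg (· ^ τ) hz
    simpa [mul_pow, hpair] using h3
  have : 2 * μ = (μ + s) + (μ - s) := by ring
  rw [this]
  exact (hroot _ hpair).add (hroot _ hpair2)

/-- The matrix `(boundary G)ᴴ * L` is fixed by `U ^ 12` when `L` is an eigenmatrix of `A / D` for a
suitable eigenvalue. -/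
theorem timeEvolution_pow_twelve_mul {D : ℕ} (hreg : G.IsRegularOfDegree D) (hD : 0 < D)
    {μ : ℂ} {L : Matrix V V ℂ} (hL : ((D : ℂ)⁻¹ • G.adjMatrix ℂ) * L = μ • L)
    (hμ : μ = 1 ∨ μ = 1 / 2 ∨ μ = 0 ∨ μ = -(1 / 2)) :
    timeEvolution G ^ 12 * ((boundary G)ᴴ * L) = (boundary G)ᴴ * L := by
  set U := timeEvolution G
  set f := (boundary G)ᴴ * L with hf
  set g := shift G * f with hg
  have hUf : U * f = g := by
    rw [hg, hf, ← Matrix.mul_assoc, timeEvolution_mul_conjTranspose_boundary hreg hD,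
      Matrix.mul_assoc]
  have hUg : U * g = (2 * μ) • g - f := by
    rw [hg, hf, ← Matrix.mul_assoc (shift G), ← Matrix.mul_assoc U,
      timeEvolution_mul_shift_mul_conjTranspose hreg,
      Matrix.sub_mul, Matrix.smul_mul, Matrix.mul_assoc _ _ L, hL, Matrix.mul_smul,
      smul_smul]
  rcases hμ with rfl | hμ
  -- For `μ = 1` the quadratic has a double root, so the recursion alone would allow linear growth;
  -- `(g - f)* (g - f) = 0` excludes it.
  · have hfg : g = f := by
      have hff : fᴴ * f = Lᴴ * L := by
        rw [hf, Matrix.conjTranspose_mul, Matrix.conjTranspose_conjTranspose, Matrix.mul_assoc,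
          ← Matrix.mul_assoc (boundary G), boundary_mul_conjTranspose hreg hD, Matrix.one_mul]
      have hfg : fᴴ * g = Lᴴ * L := by
        rw [hg, hf, Matrix.conjTranspose_mul, Matrix.conjTranspose_conjTranspose,
          ← Matrix.mul_assoc (shift G), Matrix.mul_assoc Lᴴ, ← Matrix.mul_assoc (boundary G),
          boundary_mul_shift_mul_conjTranspose hreg, hL, one_smul]
      have hgf : gᴴ * f = Lᴴ * L := by
        have := congrArg Matrix.conjTranspose hfg
        simpa using this
      have hgg : gᴴ * g = Lᴴ * L := by
        rw [hg, Matrix.conjTranspose_mul, conjTranspose_shift, Matrix.mul_assoc,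
          ← Matrix.mul_assoc (shift G), shift_mul_shift, Matrix.one_mul, hff]
      rw [← sub_eq_zero, ← Matrix.conjTranspose_mul_self_eq_zero, Matrix.conjTranspose_sub,
        Matrix.mul_sub, Matrix.sub_mul, Matrix.sub_mul, hff, hfg, hgf, hgg]
      simp
    have h1 : U * f = f := hUf.trans hfg
    have : ∀ n : ℕ, U ^ n * f = f := by
      intro n
      induction n with
      | zero => simp
      | succ n ih => rw [pow_succ, Matrix.mul_assoc, h1, ih]
    exact this 12
  · have key : ∀ (n : ℕ) (α β : ℂ), U ^ n * f = α • g + β • f →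
        U ^ (n + 1) * f = (2 * μ * α + β) • g + (-α) • f := by
      intro n α β h
      rw [pow_succ', Matrix.mul_assoc, h, Matrix.mul_add, Matrix.mul_smul, Matrix.mul_smul, hUf, hUg]
      module
    have h0 : U ^ 0 * f = (0 : ℂ) • g + (1 : ℂ) • f := by simp
    have h12 := key _ _ _ (key _ _ _ (key _ _ _ (key _ _ _ (key _ _ _ (key _ _ _ (key _ _ _
      (key _ _ _ (key _ _ _ (key _ _ _ (key _ _ _ (key _ _ _ h0)))))))))))
    rw [show (12 : ℕ) = 0 + 1 + 1 + 1 + 1 + 1 + 1 + 1 + 1 + 1 + 1 + 1 + 1 from rfl, h12]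
    rcases hμ with rfl | rfl | rfl <;> norm_num

/-- The hypothesis on `T` is annihilation by `x (x - 1) (x - 1/2) (x + 1/2)`, so the identity splits
into eigenmatrices and `U ^ 12` fixes `d*` and `R d*`. -/
theorem timeEvolution_pow_twelve {D : ℕ} (hreg : G.IsRegularOfDegree D) (hD : 0 < D)
    {T : Matrix V V ℂ} (hT : T = (D : ℂ)⁻¹ • G.adjMatrix ℂ)
    (hpoly : T ^ 4 - T ^ 3 - (1 / 4 : ℂ) • T ^ 2 + (1 / 4 : ℂ) • T = 0) :
    timeEvolution G ^ 12 = 1 := by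
  have hp : T * (T * (T * T)) = T * (T * T) + (1 / 4 : ℂ) • (T * T) - (1 / 4 : ℂ) • T := by
    have e4 : T ^ 4 = T * (T * (T * T)) := by simp only [pow_succ, pow_zero, one_mul, mul_assoc]
    have e3 : T ^ 3 = T * (T * T) := by simp only [pow_succ, pow_zero, one_mul, mul_assoc]
    rw [e4, e3, pow_two] at hpoly
    rw [← sub_eq_zero, ← hpoly]
    module
  set U := timeEvolution G with hU
  -- The Lagrange interpolation polynomials at the nodes 1, 1/2, 0, -1/2, evaluated at `T`.
  set L₁ : Matrix V V ℂ := (4 / 3 : ℂ) • (T * (T * T)) - (1 / 3 : ℂ) • T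
  set L₂ : Matrix V V ℂ := -(4 : ℂ) • (T * (T * T)) + (2 : ℂ) • (T * T) + (2 : ℂ) • T
  set L₃ : Matrix V V ℂ := (4 : ℂ) • (T * (T * T)) - (4 : ℂ) • (T * T) - T + 1
  set L₄ : Matrix V V ℂ := -(4 / 3 : ℂ) • (T * (T * T)) + (2 : ℂ) • (T * T) - (2 / 3 : ℂ) • T
  have e₁ : T * L₁ = (1 : ℂ) • L₁ := by
    simp only [L₁, mul_sub, Matrix.mul_smul, hp]; module
  have e₂ : T * L₂ = (1 / 2 : ℂ) • L₂ := by
    simp only [L₂, mul_add, Matrix.mul_smul, hp]; module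
  have e₃ : T * L₃ = (0 : ℂ) • L₃ := by
    simp only [L₃, mul_sub, mul_add, Matrix.mul_smul, hp, mul_one]; module
  have e₄ : T * L₄ = (-(1 / 2) : ℂ) • L₄ := by
    simp only [L₄, mul_sub, mul_add, Matrix.mul_smul, hp]; module
  have hsum : L₁ + L₂ + L₃ + L₄ = 1 := by
    simp only [L₁, L₂, L₃, L₄]; module
  rw [hT] at e₁ e₂ e₃ e₄
  have hd : U ^ 12 * (boundary G)ᴴ = (boundary G)ᴴ := by
    have h : (boundary G)ᴴ = (boundary G)ᴴ * L₁ + (boundary G)ᴴ * L₂ + (boundary G)ᴴ * L₃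
        + (boundary G)ᴴ * L₄ := by
      rw [← Matrix.mul_add, ← Matrix.mul_add, ← Matrix.mul_add, hsum, Matrix.mul_one]
    rw [h, Matrix.mul_add, Matrix.mul_add, Matrix.mul_add,
      timeEvolution_pow_twelve_mul hreg hD e₁ (by simp),
      timeEvolution_pow_twelve_mul hreg hD e₂ (by simp),
      timeEvolution_pow_twelve_mul hreg hD e₃ (by simp),
      timeEvolution_pow_twelve_mul hreg hD e₄ (by simp)]
  have hRd : U ^ 12 * (shift G * (boundary G)ᴴ) = shift G * (boundary G)ᴴ := by
    rw [← timeEvolution_mul_conjTranspose_boundary hreg hD, ← Matrix.mul_assoc, ← pow_succ,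
      pow_succ', Matrix.mul_assoc, hd]
  have hU2 : U ^ 2 - 1 = (2 : ℂ) • (shift G * (boundary G)ᴴ * (boundary G * U))
      - (2 : ℂ) • ((boundary G)ᴴ * boundary G) := by
    have h1 : shift G * U = (2 : ℂ) • ((boundary G)ᴴ * boundary G) - 1 := by
      rw [hU, timeEvolution, ← Matrix.mul_assoc, shift_mul_shift, Matrix.one_mul]
    rw [pow_two]
    nth_rw 1 [hU]
    rw [timeEvolution_eq, Matrix.sub_mul, h1, Matrix.smul_mul, Matrix.mul_assoc _ (boundary G)]
    abel
  have hN : (U ^ 12 - 1) * (U ^ 2 - 1) = 0 := by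
    have h1 : (U ^ 12 - 1) * (shift G * (boundary G)ᴴ) = 0 := by
      rw [Matrix.sub_mul, hRd, Matrix.one_mul, sub_self]
    have h2 : (U ^ 12 - 1) * (boundary G)ᴴ = 0 := by
      rw [Matrix.sub_mul, hd, Matrix.one_mul, sub_self]
    rw [hU2, Matrix.mul_sub, Matrix.mul_smul, Matrix.mul_smul, ← Matrix.mul_assoc, h1,
      ← Matrix.mul_assoc (U ^ 12 - 1), h2]
    simp
  -- `U² - 1` divides `U ^ 12 - 1`, so `N = U ^ 12 - 1` squares to zero. It is also normal because
  -- `U` is unitary, and a normal nilpotent matrix is zero.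
  have hNN : (U ^ 12 - 1) * (U ^ 12 - 1) = 0 := by
    have : U ^ 12 - 1 = (U ^ 2 - 1) * (U ^ 10 + U ^ 8 + U ^ 6 + U ^ 4 + U ^ 2 + 1) := by
      noncomm_ring
    nth_rw 2 [this]
    rw [← mul_assoc, hN, zero_mul]
  have hUU : U * Uᴴ = 1 := timeEvolution_mul_conjTranspose hreg hD
  have hcomm : Commute U Uᴴ := by
    rw [Commute, SemiconjBy, hUU, mul_eq_one_comm.mp hUU]
  set N := U ^ 12 - 1 with hNdef
  have hNh : Nᴴ = Uᴴ ^ 12 - 1 := by simp [hNdef, Matrix.conjTranspose_pow]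
  have hNc : Commute N Nᴴ := by
    rw [hNh, hNdef]
    exact ((hcomm.pow_pow 12 12).sub_left (Commute.one_left _)).sub_right (Commute.one_right _)
  have hM : (Nᴴ * N)ᴴ * (Nᴴ * N) = 0 := by
    rw [Matrix.conjTranspose_mul, Matrix.conjTranspose_conjTranspose, ← hNc.eq, Matrix.mul_assoc,
      ← Matrix.mul_assoc Nᴴ N, ← hNc.eq, Matrix.mul_assoc N, ← Matrix.mul_assoc N N, hNN,
      Matrix.zero_mul]
  exact sub_eq_zero.mp (Matrix.conjTranspose_mul_self_eq_zero.mp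
    (Matrix.conjTranspose_mul_self_eq_zero.mp hM))

end Walk

/-! ### Real roots of trinomials and integrality -/

section RealRoots

/-- On `[0, ∞)` the power is strictly convex, so it stays strictly below a line that dominates it at
both ends. -/
theorem pow_lt_of_between {ℓ : ℕ} (hℓ : 2 ≤ ℓ) {a b x y z : ℝ} (hx : 0 ≤ x) (hxy : x < y)
    (hyz : y < z) (h₁ : x ^ ℓ ≤ b * x + a) (h₂ : z ^ ℓ ≤ b * z + a) : y ^ ℓ < b * y + a := by
  have h := (strictConvexOn_pow hℓ).secant_strict_mono_aux1 (Set.mem_Ici.mpr hx)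
    (Set.mem_Ici.mpr (by linarith : 0 ≤ z)) hxy hyz
  nlinarith

theorem pow_lt_of_between_of_even {ℓ : ℕ} (hℓ : ℓ ≠ 0) (he : Even ℓ) {a b x y z : ℝ}
    (hxy : x < y) (hyz : y < z) (h₁ : x ^ ℓ = b * x + a) (h₂ : z ^ ℓ = b * z + a) :
    y ^ ℓ < b * y + a := by
  have h := (he.strictConvexOn_pow hℓ).secant_strict_mono_aux1 (Set.mem_univ x)
    (Set.mem_univ z) hxy hyz
  rw [h₁, h₂] at h
  nlinarith

theorem neg_pow_eq {ℓ : ℕ} (ho : Odd ℓ) {a b x : ℝ} (h : x ^ ℓ = b * x + a) :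
    (-x) ^ ℓ = b * (-x) + -a := by
  rw [ho.neg_pow, h]; ring

/-- Equality holds at exponent 3. If `u` and `v` both satisfy `y ^ ℓ = b y - a`, the left side
becomes `(v - u) (b (u + v) + a)`, so at `u + v` the power is at least `b (u + v) + a`. -/
theorem pow_add_ineq {u v : ℝ} (hu : 0 ≤ u) (huv : u ≤ v) (m : ℕ) :
    (v - u) * (u ^ (m + 3) + v ^ (m + 3)) + 3 * (u * v ^ (m + 3) - v * u ^ (m + 3)) ≤
      (v - u) * (u + v) ^ (m + 3) := by
  induction m with
  | zero => apply le_of_eq; ring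
  | succ m ih =>
    have hv : 0 ≤ v := hu.trans huv
    have h1 := mul_le_mul_of_nonneg_left ih (add_nonneg hu hv)
    have h2 : u ^ m ≤ v ^ m := pow_le_pow_left₀ hu huv m
    have h3 : u ^ m * (u ^ 2 * (2 * v + u)) ≤ v ^ m * (v ^ 2 * (v + 2 * u)) := by
      apply mul_le_mul h2 _ (by positivity) (by positivity)
      nlinarith [mul_nonneg (mul_nonneg hu hv) (sub_nonneg.mpr huv),
        mul_nonneg (sub_nonneg.mpr huv) (sq_nonneg u), mul_nonneg (sub_nonneg.mpr huv) (sq_nonneg v),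
        mul_nonneg (sub_nonneg.mpr huv) (mul_nonneg hu hv)]
    have h4 := mul_le_mul_of_nonneg_left h3 (mul_nonneg hu hv)
    ring_nf at h1 h4 ⊢
    linarith

/-- The shape of three real roots of `x ^ ℓ = b x + a`, `ℓ` odd, whose middle one is nonpositive. -/
theorem three_roots_shape {ℓ : ℕ} (hℓ : 2 ≤ ℓ) (ho : Odd ℓ) {a b x₁ x₂ x₃ : ℝ}
    (h₁ : x₁ ^ ℓ = b * x₁ + a) (h₂ : x₂ ^ ℓ = b * x₂ + a) (h₃ : x₃ ^ ℓ = b * x₃ + a)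
    (h12 : x₂ < x₁) (h23 : x₃ < x₂) (hx : x₂ ≤ 0) :
    0 < x₁ ∧ -x₃ ≤ x₁ ∧ x₁ + x₂ + x₃ ≤ 0 ∧ (x₂ < 0 → -x₃ < x₁) := by
  have n₁ := neg_pow_eq ho h₁
  have n₂ := neg_pow_eq ho h₂
  have n₃ := neg_pow_eq ho h₃
  have z0 : (0 : ℝ) ^ ℓ = 0 := zero_pow (by omega)
  have hpos : 0 < x₁ := by
    by_contra hneg
    have := pow_lt_of_between hℓ (a := -a) (b := b) (x := -x₁) (y := -x₂) (z := -x₃)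
      (by linarith) (by linarith) (by linarith) n₁.le n₃.le
    linarith
  have ha : x₂ < 0 → 0 < a := by
    intro hneg
    by_contra hna
    have := pow_lt_of_between hℓ (a := -a) (b := b) (x := 0) (y := -x₂) (z := -x₃)
      le_rfl (by linarith) (by linarith) (by rw [z0]; linarith) n₃.le
    linarith
  have ha0 : 0 ≤ a := by
    rcases hx.lt_or_eq with h | h
    · exact (ha h).le
    · rw [h, z0] at h₂; linarith
  have hle : -x₃ ≤ x₁ := by
    by_contra hlt
    have := pow_lt_of_between hℓ (a := a) (b := b) (x := 0) (y := x₁) (z := -x₃)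
      le_rfl hpos (by linarith) (by rw [z0]; linarith) (by linarith)
    linarith
  refine ⟨hpos, hle, ?_, fun h => lt_of_le_of_ne hle ?_⟩
  · by_contra hlt
    -- A positive sum would place `-x₂ - x₃` strictly between 0 and `x₁`, where the power lies below
    -- the line; `pow_add_ineq` says the opposite.
    have h5 := pow_lt_of_between hℓ (a := a) (b := b) (x := 0) (y := -x₂ + -x₃) (z := x₁)
      le_rfl (by linarith) (by linarith) (by rw [z0]; linarith) h₁.le
    obtain ⟨m, rfl⟩ : ∃ m, ℓ = m + 3 := by
      obtain ⟨j, rfl⟩ := ho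
      exact ⟨2 * j + 1 - 3, by omega⟩
    have h6 := pow_add_ineq (u := -x₂) (v := -x₃) (by linarith) (by linarith) m
    rw [n₂, n₃] at h6
    have h7 := mul_lt_mul_of_pos_left h5 (by linarith : 0 < -x₃ - -x₂)
    nlinarith
  · intro heq
    rw [heq, h₁] at n₃
    have := ha h
    nlinarith

theorem odd_of_three_roots {ℓ : ℕ} (hℓ : 2 ≤ ℓ) {a b x₁ x₂ x₃ : ℝ}
    (h₁ : x₁ ^ ℓ = b * x₁ + a) (h₂ : x₂ ^ ℓ = b * x₂ + a) (h₃ : x₃ ^ ℓ = b * x₃ + a)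
    (h12 : x₂ < x₁) (h23 : x₃ < x₂) : Odd ℓ := by
  by_contra h
  have := pow_lt_of_between_of_even (by omega) (Nat.not_odd_iff_even.mp h) h23 h12 h₃ h₁
  linarith

/-- Since `ℓ` is odd, the shape of three roots makes the two largest positive and the two smallest
negative. Convexity then gives `a < 0` from the positive pair and `a > 0` from the negative pair. -/
theorem not_four_roots {ℓ : ℕ} (hℓ : 2 ≤ ℓ) {a b x₁ x₂ x₃ x₄ : ℝ}
    (h₁ : x₁ ^ ℓ = b * x₁ + a) (h₂ : x₂ ^ ℓ = b * x₂ + a) (h₃ : x₃ ^ ℓ = b * x₃ + a)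
    (h₄ : x₄ ^ ℓ = b * x₄ + a) (h12 : x₂ < x₁) (h23 : x₃ < x₂) (h34 : x₄ < x₃) : False := by
  have ho := odd_of_three_roots hℓ h₁ h₂ h₃ h12 h23
  have z0 : (0 : ℝ) ^ ℓ = 0 := zero_pow (by omega)
  have hx₂ : 0 < x₂ := by
    by_contra h
    exact h (three_roots_shape hℓ ho h₂ h₃ h₄ h23 h34 (by linarith)).1
  have hx₃ : x₃ < 0 := by
    by_contra h
    have := (three_roots_shape hℓ ho (neg_pow_eq ho h₃) (neg_pow_eq ho h₂) (neg_pow_eq ho h₁)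
      (by linarith) (by linarith) (by linarith)).1
    linarith
  have ha : a < 0 := by
    by_contra h
    have := pow_lt_of_between hℓ (a := a) (b := b) le_rfl hx₂ h12 (by rw [z0]; linarith) h₁.le
    linarith
  have := pow_lt_of_between hℓ (a := -a) (b := b) (x := 0) (y := -x₃) (z := -x₄) le_rfl
    (by linarith) (by linarith) (by rw [z0]; linarith) (neg_pow_eq ho h₄).le
  have := neg_pow_eq ho h₃
  linarith

/-- The root bounds leave only the sums 0 and -1. For -1, the integer `(1 + x₁) (1 + x₂) (1 + x₃) =
q + r` would lie strictly between 0 and 1. -/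
theorem sum_eq_zero_of_middle_nonpos {ℓ : ℕ} (hℓ : 2 ≤ ℓ) (ho : Odd ℓ) {a b x₁ x₂ x₃ : ℝ}
    (h₁ : x₁ ^ ℓ = b * x₁ + a) (h₂ : x₂ ^ ℓ = b * x₂ + a) (h₃ : x₃ ^ ℓ = b * x₃ + a)
    (h12 : x₂ < x₁) (h23 : x₃ < x₂) (hx : x₂ ≤ 0) (hb : x₁ ≤ 2)
    {p q r : ℤ} (hp : x₁ + x₂ + x₃ = p) (hq : x₁ * x₂ + x₁ * x₃ + x₂ * x₃ = q)
    (hr : x₁ * x₂ * x₃ = r) : p = 0 := by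
  obtain ⟨hpos, hle, hsum, hlt⟩ := three_roots_shape hℓ ho h₁ h₂ h₃ h12 h23 hx
  have hp0 : p ≤ 0 := by
    have : (p : ℝ) ≤ 0 := by linarith
    exact_mod_cast this
  have hp1 : -2 < p := by
    have : (-2 : ℝ) < p := by linarith
    exact_mod_cast this
  have : p = 0 ∨ p = -1 := by omega
  refine this.resolve_right fun h => ?_
  subst h
  push_cast at hp
  have hu : x₂ < 0 := by linarith
  have hv := hlt hu
  have hx1 : x₁ = -x₂ - x₃ - 1 := by linarith
  have e : (-x₂ - x₃) * ((-x₂ - 1) * (-x₃ - 1)) = (q + r : ℤ) := by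
    push_cast
    rw [← hq, ← hr, hx1]; ring
  have hu1 : 0 < -x₂ - 1 := by linarith
  have hv1 : 0 < -x₃ - 1 := by linarith
  have hpos' : 0 < (-x₂ - x₃) * ((-x₂ - 1) * (-x₃ - 1)) := by
    apply mul_pos (by linarith) (mul_pos hu1 hv1)
  have hs : -x₂ - x₃ ≤ 3 := by linarith
  have hlt1 : (-x₂ - x₃) * ((-x₂ - 1) * (-x₃ - 1)) < 1 := by
    -- AM-GM: the factors are positive with sum at most 1, so the whole product is at most 3/4.
    have h4 : (-x₂ - 1) * (-x₃ - 1) ≤ 1 / 4 := by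
      nlinarith [sq_nonneg (x₂ - x₃)]
    nlinarith [mul_pos hu1 hv1]
  rw [e] at hpos' hlt1
  have c1 : 0 < q + r := by exact_mod_cast hpos'
  have c2 : q + r < 1 := by exact_mod_cast hlt1
  omega

theorem sum_eq_zero_of_roots {ℓ : ℕ} (hℓ : 2 ≤ ℓ) {a b x₁ x₂ x₃ : ℝ}
    (h₁ : x₁ ^ ℓ = b * x₁ + a) (h₂ : x₂ ^ ℓ = b * x₂ + a) (h₃ : x₃ ^ ℓ = b * x₃ + a)
    (h12 : x₂ < x₁) (h23 : x₃ < x₂) (hb₁ : x₁ ≤ 2) (hb₃ : -2 ≤ x₃)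
    {p q r : ℤ} (hp : x₁ + x₂ + x₃ = p) (hq : x₁ * x₂ + x₁ * x₃ + x₂ * x₃ = q)
    (hr : x₁ * x₂ * x₃ = r) : p = 0 := by
  have ho := odd_of_three_roots hℓ h₁ h₂ h₃ h12 h23
  rcases le_total x₂ 0 with hx | hx
  · exact sum_eq_zero_of_middle_nonpos hℓ ho h₁ h₂ h₃ h12 h23 hx hb₁ hp hq hr
  · have := sum_eq_zero_of_middle_nonpos hℓ ho (neg_pow_eq ho h₃) (neg_pow_eq ho h₂)
      (neg_pow_eq ho h₁) (by linarith) (by linarith) (by linarith) (by linarith)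
      (p := -p) (q := q) (r := -r) (by push_cast; linarith) (by linarith)
      (by push_cast; linarith)
    omega

/-- The integer cubics `x³ - q x - r` with three distinct roots in `[-2, 2)`. -/
theorem coeff_cases {x₁ x₂ x₃ : ℝ} (h12 : x₂ < x₁) (h23 : x₃ < x₂) (hb₁ : x₁ < 2) (hb₃ : -2 ≤ x₃)
    (hp : x₁ + x₂ + x₃ = 0) {q r : ℤ} (hq : x₁ * x₂ + x₁ * x₃ + x₂ * x₃ = -q)
    (hr : x₁ * x₂ * x₃ = r) :
    (q = 1 ∧ r = 0) ∨ ((q = 2 ∨ q = 3) ∧ (r = 0 ∨ r = 1 ∨ r = -1)) := by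
  have hx : x₃ = -x₁ - x₂ := by linarith
  -- The discriminant is positive, the cubic is positive at 2 and nonpositive at -2. The last two
  -- facts give `q ≤ 3`; the discriminant then gives `q > 0` and `|r| ≤ 1`.
  have d1 : (0 : ℝ) < 4 * q ^ 3 - 27 * r ^ 2 := by
    have : (4 * q ^ 3 - 27 * r ^ 2 : ℝ) = ((x₁ - x₂) * (x₂ - x₃) * (x₁ - x₃)) ^ 2 := by
      have : (q : ℝ) = -(x₁ * x₂ + x₁ * x₃ + x₂ * x₃) := by linarith
      rw [this, ← hr, hx]; ring
    rw [this]
    have := mul_pos (mul_pos (sub_pos.mpr h12) (sub_pos.mpr h23)) (sub_pos.mpr (h23.trans h12))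
    positivity
  have d2 : (0 : ℝ) < 8 - 2 * q - r := by
    have : (8 - 2 * q - r : ℝ) = (2 - x₁) * (2 - x₂) * (2 - x₃) := by
      linear_combination 4 * hp - 2 * hq + hr
    rw [this]
    exact mul_pos (mul_pos (by linarith) (by linarith)) (by linarith)
  have d3 : (0 : ℝ) ≤ 8 - 2 * q + r := by
    have : (8 - 2 * q + r : ℝ) = (2 + x₁) * (2 + x₂) * (2 + x₃) := by
      linear_combination -4 * hp - 2 * hq - hr
    rw [this]
    exact mul_nonneg (mul_nonneg (by linarith) (by linarith)) (by linarith)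
  have i1 : 0 < 4 * q ^ 3 - 27 * r ^ 2 := by exact_mod_cast d1
  have i2 : 0 < 8 - 2 * q - r := by exact_mod_cast d2
  have i3 : 0 ≤ 8 - 2 * q + r := by exact_mod_cast d3
  have hq3 : q ≤ 3 := by omega
  have hq0 : 0 < q := by
    by_contra h
    have : q ^ 3 ≤ 0 := Odd.pow_nonpos (by decide) (by omega)
    nlinarith [sq_nonneg r]
  have hr1 : r ≤ 1 := by
    by_contra h
    have : q ^ 3 ≤ 27 := by interval_cases q <;> norm_num
    nlinarith
  have hr2 : -1 ≤ r := by
    by_contra h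
    have : q ^ 3 ≤ 27 := by interval_cases q <;> norm_num
    nlinarith
  interval_cases q <;> interval_cases r <;> simp_all

end RealRoots

/-! ### Excluding the remaining cubics by traces -/

section Exclusion

theorem eq_zero_of_mul_eq_intCast {d : ℕ} (hd : d.Prime) {s : ℝ} (hs : s ^ 2 = d) {α β : ℤ}
    (h : α * s = β) : α = 0 := by
  by_contra hα
  have hα' : (α : ℝ) ≠ 0 := by exact_mod_cast hα
  refine hd.irrational_sqrt ⟨|(β : ℚ) / α|, ?_⟩
  rw [← hs, Real.sqrt_sq_eq_abs, eq_div_of_mul_eq hα' ((mul_comm _ _).trans h)]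
  push_cast
  rfl

-- `x³ - 3x + 1` has no rational root, hence is irreducible over `ℚ`, and `1, x, x²` are linearly
-- independent.
open Polynomial in
theorem coeffs_eq_zero_of_cubic {x : ℝ} (hx : x ^ 3 = 3 * x - 1) {α β γ : ℤ}
    (h : α * x ^ 2 + β * x + γ = 0) : α = 0 ∧ β = 0 ∧ γ = 0 := by
  set P : ℚ[X] := X ^ 3 + C 0 * X ^ 2 + C (-3) * X + C 1 with hP
  have hdeg : P.natDegree = 3 := by
    rw [hP]; compute_degree!
  have hmonic : P.Monic := by
    rw [hP]; monicity!
  have hirr : Irreducible P := by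
    rw [hmonic.irreducible_iff_roots_eq_zero_of_degree_le_three (by omega) (by omega)]
    rw [Multiset.eq_zero_iff_forall_notMem]
    intro y hy
    have hy0 : y ^ 3 - 3 * y + 1 = 0 := by
      have := (mem_roots'.mp hy).2
      simp [hP, IsRoot.def] at this
      linarith
    have hint : IsIntegral ℤ y := by
      refine ⟨X ^ 3 + C (-3) * X + C 1, by monicity!, ?_⟩
      simp
      linarith
    obtain ⟨n, rfl⟩ := IsIntegrallyClosed.isIntegral_iff.mp hint
    simp only [algebraMap_int_eq, eq_intCast] at hy0
    have hn : n ^ 3 - 3 * n + 1 = 0 := by exact_mod_cast hy0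
    have hdvd : n ∣ 1 := ⟨3 - n ^ 2, by linarith⟩
    rcases Int.isUnit_iff.mp (isUnit_of_dvd_one hdvd) with rfl | rfl <;> norm_num at hn
  have hmin : P = minpoly ℚ x := minpoly.eq_of_irreducible_of_monic hirr
    (by simp [hP]; linarith) hmonic
  obtain ⟨a, ha⟩ : ∃ a : ℚ, a = α := ⟨_, rfl⟩
  obtain ⟨b, hb⟩ : ∃ b : ℚ, b = β := ⟨_, rfl⟩
  obtain ⟨c, hc⟩ : ∃ c : ℚ, c = γ := ⟨_, rfl⟩
  set Q : ℚ[X] := C a * X ^ 2 + C b * X + C c with hQ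
  have hQ0 : Q = 0 := by
    by_contra hne
    have h1 := minpoly.degree_le_of_ne_zero ℚ x hne (by simp [hQ, ha, hb, hc, h])
    rw [← hmin, degree_eq_natDegree hmonic.ne_zero, hdeg] at h1
    have h2 : Q.degree ≤ 2 := degree_quadratic_le
    exact absurd (h1.trans h2) (by decide)
  have c0 := congrArg (fun p => coeff p 0) hQ0
  have c1 := congrArg (fun p => coeff p 1) hQ0
  have c2 := congrArg (fun p => coeff p 2) hQ0
  simp only [hQ, coeff_add, coeff_C_mul, coeff_X_pow, coeff_X, coeff_C, coeff_zero] at c0 c1 c2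
  norm_num at c0 c1 c2
  rw [ha] at c2
  rw [hb] at c1
  rw [hc] at c0
  exact ⟨by exact_mod_cast c2, by exact_mod_cast c1, by exact_mod_cast c0⟩

/-- The discriminant 81 is a square, so the field of `x₁` contains the other roots; explicitly `x₂ =
x₁² - 2`. Comparing coefficients of `1, x₁, x₁²` forces equal multiplicities, and then the zero root
sum gives `c = 0`. -/
theorem eq_zero_of_cubic_sum {x₁ x₂ x₃ : ℝ} (h12 : x₂ < x₁) (h23 : x₃ < x₂)
    (hp : x₁ + x₂ + x₃ = 0) (hq : x₁ * x₂ + x₁ * x₃ + x₂ * x₃ = -3) (hr : x₁ * x₂ * x₃ = -1)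
    {m₁ m₂ m₃ c : ℤ} (h : m₁ * x₁ + m₂ * x₂ + m₃ * x₃ = c) : c = 0 := by
  have hx : x₃ = -x₁ - x₂ := by linarith
  have hcub : x₁ ^ 3 = 3 * x₁ - 1 := by
    linear_combination x₁ ^ 2 * hp - x₁ * hq + hr
  have hV : (x₁ - x₂) * (x₂ - x₃) * (x₁ - x₃) = 9 := by
    have h0 := mul_pos (mul_pos (sub_pos.mpr h12) (sub_pos.mpr h23))
      (sub_pos.mpr (h23.trans h12))
    have h1 : ((x₁ - x₂) * (x₂ - x₃) * (x₁ - x₃)) ^ 2 = 9 ^ 2 := by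
      have : ((x₁ - x₂) * (x₂ - x₃) * (x₁ - x₃)) ^ 2 =
          -4 * (x₁ * x₂ + x₁ * x₃ + x₂ * x₃) ^ 3 - 27 * (x₁ * x₂ * x₃) ^ 2 := by
        rw [hx]; ring
      rw [this, hq, hr]; norm_num
    exact (pow_left_inj₀ h0.le (by norm_num) two_ne_zero).mp h1
  -- The derivative of the cubic at `x₁`; dividing the Vandermonde product 9 by it yields `x₂ - x₃`.
  have hd : (x₁ - x₂) * (x₁ - x₃) = 3 * (x₁ ^ 2 - 1) := by
    linear_combination -2 * x₁ * hp + hq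
  have hne : x₁ ^ 2 - 1 ≠ 0 := by
    have := mul_pos (sub_pos.mpr h12) (sub_pos.mpr (h23.trans h12))
    rw [hd] at this
    linarith
  have hδ : x₂ - x₃ = 2 * x₁ ^ 2 + x₁ - 4 := by
    apply mul_left_cancel₀ hne
    have h1 : (x₁ ^ 2 - 1) * (x₂ - x₃) = 3 := by
      linear_combination hV / 3 - (x₂ - x₃) * hd / 3
    rw [h1]
    linear_combination (-2 * x₁ - 1) * hcub
  have hx2 : x₂ = x₁ ^ 2 - 2 := by linarith
  obtain ⟨h1, h2, h3⟩ := coeffs_eq_zero_of_cubic hcub (α := m₂ - m₃) (β := m₁ - m₃)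
    (γ := 2 * (m₃ - m₂) - c) (by
      push_cast
      rw [hx, hx2] at h
      linear_combination h)
  omega

/-- The `mᵢ` are eigenvalue multiplicities, and `ht₁`, `ht₂` are the rescaled traces of `A` and
`A²`. Irrational conjugate roots must have equal multiplicities. This contradicts trace zero except
for the golden-ratio cubics `x³ - 2x ∓ 1`, which need the second trace. -/
theorem cubic_coeffs_of_traces {x₁ x₂ x₃ : ℝ} (h12 : x₂ < x₁) (h23 : x₃ < x₂) (hb₁ : x₁ < 2)
    (hb₃ : -2 ≤ x₃) (hp : x₁ + x₂ + x₃ = 0) {q r : ℤ}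
    (hq : x₁ * x₂ + x₁ * x₃ + x₂ * x₃ = -q) (hr : x₁ * x₂ * x₃ = r)
    {D m₀ m₁ m₂ m₃ : ℕ} (hD : 0 < D) (hm₀ : 0 < m₀) (hm₁ : 0 < m₁) (hm₂ : 0 < m₂) (hm₃ : 0 < m₃)
    (ht₁ : 2 * m₀ + m₁ * x₁ + m₂ * x₂ + m₃ * x₃ = 0)
    (ht₂ : D * (4 * m₀ + m₁ * x₁ ^ 2 + m₂ * x₂ ^ 2 + m₃ * x₃ ^ 2) = 4 * (m₀ + m₁ + m₂ + m₃)) :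
    x₁ = 1 ∧ x₂ = 0 ∧ x₃ = -1 := by
  have hcub : ∀ x ∈ ({x₁, x₂, x₃} : Set ℝ), x ^ 3 = q * x + r := by
    have hq' : (q : ℝ) = -(x₁ * x₂ + x₁ * x₃ + x₂ * x₃) := by linarith
    have hx : x₃ = -x₁ - x₂ := by linarith
    rintro x (rfl | rfl | rfl) <;> rw [← hr, hq', hx] <;> ring
  have c₁ := hcub x₁ (by simp)
  have c₂ := hcub x₂ (by simp)
  have c₃ := hcub x₃ (by simp)
  have hpos : 0 < x₁ := by linarith
  have hneg : x₃ < 0 := by linarith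
  have hmid : r = 0 → x₂ = 0 := by
    rintro rfl
    simpa [hpos.ne', hneg.ne] using hr
  have hsqrt : ∀ d : ℕ, d.Prime → r = 0 → q = d → False := by
    intro d hd h0 hqd
    have h2 := hmid h0
    have h3 : x₃ = -x₁ := by linarith
    have hs : x₁ ^ 2 = d := by
      rw [h2, h3, hqd] at hq
      push_cast at hq
      linarith
    have := eq_zero_of_mul_eq_intCast hd hs (α := m₁ - m₃) (β := -(2 * m₀)) (by
      push_cast
      rw [h2, h3] at ht₁
      linear_combination ht₁)
    have h4 : (m₁ : ℝ) = m₃ := by exact_mod_cast sub_eq_zero.mp this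
    rw [h2, h3, h4] at ht₁
    have : (m₀ : ℝ) = 0 := by linarith
    exact hm₀.ne' (by exact_mod_cast this)
  rcases coeff_cases h12 h23 hb₁ hb₃ hp hq hr with ⟨rfl, hr0⟩ | ⟨rfl | rfl, hr0 | hr0 | hr0⟩
  · have h2 := hmid hr0
    have h3 : x₃ = -x₁ := by linarith
    rw [h2, h3] at hq
    have h1 : x₁ = 1 := by
      push_cast at hq
      nlinarith
    exact ⟨h1, h2, by linarith⟩
  · exact (hsqrt 2 Nat.prime_two hr0 (by norm_num)).elim
  · exfalso
    subst hr0
    push_cast at c₁ c₂ c₃ hq hr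
    -- The cubic is `(x + 1) (x² - x - 1)`, and -1 lies below the negative root of the quadratic
    -- factor.
    have h3 : x₃ = -1 := by
      by_contra hne
      have h3 : x₃ ^ 2 - x₃ - 1 = 0 := by
        apply mul_left_cancel₀ (fun h => hne (by linarith) : x₃ + 1 ≠ 0)
        linear_combination c₃
      have h2 : x₂ < 0 := by
        by_contra h
        nlinarith [mul_nonneg hpos.le (not_lt.mp h)]
      have h2' : x₂ ≠ -1 → x₂ ^ 2 - x₂ - 1 = 0 := fun hne => by
        apply mul_left_cancel₀ (fun h => hne (by linarith) : x₂ + 1 ≠ 0)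
        linear_combination c₂
      by_cases h : x₂ = -1
      · nlinarith
      · have := h2' h
        nlinarith
    subst h3
    have h2 : x₂ = 1 - x₁ := by linarith
    subst h2
    have h1 : x₁ ^ 2 = x₁ + 1 := by linarith
    have := eq_zero_of_mul_eq_intCast (d := 5) (by norm_num) (s := 2 * x₁ - 1)
      (by push_cast; linear_combination 4 * h1) (α := m₁ - m₂)
      (β := 2 * m₃ - 4 * m₀ - m₁ - m₂) (by
        push_cast
        linear_combination 2 * ht₁)
    obtain rfl : m₁ = m₂ := by omega
    have t1 : 2 * m₀ + m₁ = m₃ := by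
      have : (2 * m₀ + m₁ : ℝ) = m₃ := by linear_combination ht₁
      exact_mod_cast this
    have t2 : D * (4 * m₀ + 3 * m₁ + m₃) = 4 * (m₀ + m₁ + m₁ + m₃) := by
      have : (D * (4 * m₀ + 3 * m₁ + m₃) : ℝ) = 4 * (m₀ + m₁ + m₁ + m₃) := by
        linear_combination ht₂ - 2 * D * m₁ * h1
      exact_mod_cast this
    subst t1
    -- The traces combine to `D (6 m₀ + 4 m₁) = 12 m₀ + 12 m₁`: the left side is too small for `D ≤
    -- 2` and too large for `D ≥ 3`.
    rcases (by omega : D = 1 ∨ D = 2 ∨ 3 ≤ D) with rfl | rfl | hD3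
    · omega
    · omega
    · have := Nat.mul_le_mul_right (4 * m₀ + 3 * m₁ + (2 * m₀ + m₁)) hD3
      omega
  · exfalso
    subst hr0
    push_cast at c₁ c₂ c₃ hq hr
    have h3 : x₁ = 1 := by
      by_contra hne
      have h3 : x₁ ^ 2 + x₁ - 1 = 0 := by
        apply mul_left_cancel₀ (fun h => hne (by linarith) : x₁ - 1 ≠ 0)
        linear_combination c₁
      have h2 : 0 < x₂ := by
        by_contra h
        nlinarith [mul_nonneg_of_nonpos_of_nonpos (not_lt.mp h) hneg.le]
      have h2' : x₂ ≠ 1 → x₂ ^ 2 + x₂ - 1 = 0 := fun hne => by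
        apply mul_left_cancel₀ (fun h => hne (by linarith) : x₂ - 1 ≠ 0)
        linear_combination c₂
      by_cases h : x₂ = 1
      · nlinarith
      · have := h2' h
        nlinarith
    subst h3
    have h2 : x₂ = -1 - x₃ := by linarith
    subst h2
    have h1 : x₃ ^ 2 = -x₃ + 1 := by linarith
    have := eq_zero_of_mul_eq_intCast (d := 5) (by norm_num) (s := 2 * x₃ + 1)
      (by push_cast; linear_combination 4 * h1) (α := m₃ - m₂)
      (β := m₃ + m₂ - 4 * m₀ - 2 * m₁) (by
        push_cast
        linear_combination 2 * ht₁)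
    obtain rfl : m₃ = m₂ := by omega
    have t1 : 2 * m₀ + m₁ = m₃ := by
      have : (2 * m₀ + m₁ : ℝ) = m₃ := by linear_combination ht₁
      exact_mod_cast this
    have t2 : D * (4 * m₀ + m₁ + 3 * m₃) = 4 * (m₀ + m₁ + m₃ + m₃) := by
      have : (D * (4 * m₀ + m₁ + 3 * m₃) : ℝ) = 4 * (m₀ + m₁ + m₃ + m₃) := by
        linear_combination ht₂ - 2 * D * m₃ * h1
      exact_mod_cast this
    subst t1
    -- Here the equation is `D (10 m₀ + 4 m₁) = 20 m₀ + 12 m₁`, impossible in the same way.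
    rcases (by omega : D = 1 ∨ D = 2 ∨ 3 ≤ D) with rfl | rfl | hD3
    · omega
    · omega
    · have := Nat.mul_le_mul_right (4 * m₀ + m₁ + 3 * (2 * m₀ + m₁)) hD3
      omega
  · exact (hsqrt 3 Nat.prime_three hr0 (by norm_num)).elim
  · exfalso
    subst hr0
    push_cast at hq hr
    have := eq_zero_of_cubic_sum (x₁ := -x₃) (x₂ := -x₂) (x₃ := -x₁) (by linarith) (by linarith)
      (by linarith) (by linarith) (by linarith) (m₁ := m₃) (m₂ := m₂) (m₃ := m₁) (c := 2 * m₀)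
      (by push_cast; linear_combination -ht₁)
    omega
  · exfalso
    subst hr0
    push_cast at hq hr
    have := eq_zero_of_cubic_sum h12 h23 hp (by linarith) (by linarith) (m₁ := m₁) (m₂ := m₂)
      (m₃ := m₃) (c := -(2 * m₀)) (by push_cast; linear_combination ht₁)
    omega

end Exclusion

/-! ### Spectra of real symmetric matrices and rationality -/

section Spectrum

variable {V : Type*} [Fintype V] [DecidableEq V]

theorem exists_eigenvector {A : Matrix V V ℝ} (hA : A.IsHermitian) {t : ℝ}
    (ht : t ∈ spectrum ℝ A) : ∃ v : V → ℝ, v ≠ 0 ∧ A *ᵥ v = t • v := by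
  rw [hA.spectrum_real_eq_range_eigenvalues] at ht
  obtain ⟨i, rfl⟩ := ht
  exact ⟨_, (WithLp.ofLp_eq_zero 2).ne.2 <| hA.eigenvectorBasis.orthonormal.ne_zero i,
    hA.mulVec_eigenvectorBasis i⟩

theorem mem_spectrum_of_eigenvector {A : Matrix V V ℝ} {t : ℝ} {v : V → ℝ} (hv : v ≠ 0)
    (h : A *ᵥ v = t • v) : t ∈ spectrum ℝ A := by
  rw [← Matrix.spectrum_toLin']
  exact (Module.End.hasEigenvalue_of_hasEigenvector (x := v)
    ⟨Module.End.mem_eigenspace_iff.mpr (by simpa using h), hv⟩).mem_spectrum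

theorem pow_mulVec_eigenvector {A : Matrix V V ℝ} {t : ℝ} {v : V → ℝ} (h : A *ᵥ v = t • v)
    (n : ℕ) : (A ^ n) *ᵥ v = t ^ n • v := by
  induction n with
  | zero => simp
  | succ n ih =>
    rw [pow_succ, ← Matrix.mulVec_mulVec, h, Matrix.mulVec_smul, ih, smul_smul, pow_succ, mul_comm]

theorem trace_sq_eq_sum_eigenvalues {A : Matrix V V ℝ} (hA : A.IsHermitian) :
    (A * A).trace = ∑ i, hA.eigenvalues i ^ 2 := by
  conv_lhs => rw [hA.spectral_theorem, ← map_mul, Unitary.conjStarAlgAut_apply,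
    Matrix.trace_mul_comm, ← mul_assoc]
  simp [pow_two, Matrix.trace]

/-- A Hermitian matrix is annihilated by a polynomial that vanishes on its spectrum. -/
theorem aeval_eq_zero_of_spectrum {A : Matrix V V ℝ} (hA : A.IsHermitian) (p : Polynomial ℝ)
    (hp : ∀ t ∈ spectrum ℝ A, p.eval t = 0) : Polynomial.aeval A p = 0 := by
  have hd : ∀ d : V → ℝ, Polynomial.aeval (Matrix.diagonal d) p =
      Matrix.diagonal fun i => p.eval (d i) := by
    intro d
    have := Polynomial.aeval_algHom_apply (Matrix.diagonalAlgHom (n := V) (α := ℝ) ℝ) d p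
    simp only [Matrix.diagonalAlgHom_apply] at this
    rw [this]
    congr 1
    funext i
    simp
  conv_lhs => rw [hA.spectral_theorem]
  have h := Polynomial.aeval_algHom_apply
    ((Unitary.conjStarAlgAut ℝ (Matrix V V ℝ) hA.eigenvectorUnitary : _ ≃⋆ₐ[ℝ] _) :
      Matrix V V ℝ →ₐ[ℝ] Matrix V V ℝ) (Matrix.diagonal (RCLike.ofReal ∘ hA.eigenvalues)) p
  refine Eq.trans h ?_
  rw [hd]
  have : (fun i => p.eval ((RCLike.ofReal ∘ hA.eigenvalues : V → ℝ) i)) = 0 := by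
    funext i
    exact hp _ (hA.eigenvalues_mem_spectrum_real i)
  rw [this]
  simp

open Polynomial UniqueFactorizationMonoid in
/-- The monic polynomial with the distinct roots of a rational polynomial that splits over `ℝ` as its
simple roots has rational coefficients. -/
theorem exists_rational_prod_roots {P : ℚ[X]} (hP : P ≠ 0) (hs : (P.map (algebraMap ℚ ℝ)).Splits)
    {S : Finset ℝ} (hS : ∀ x, x ∈ S ↔ aeval x P = 0) :
    ∃ Q : ℚ[X], Q.map (algebraMap ℚ ℝ) = ∏ x ∈ S, (X - C x) := by
  have hR0 : radical P ≠ 0 := radical_ne_zero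
  have hPm : P.map (algebraMap ℚ ℝ) ≠ 0 :=
    (Polynomial.map_ne_zero_iff (algebraMap ℚ ℝ).injective).mpr hP
  have hRs : ((radical P).map (algebraMap ℚ ℝ)).Splits :=
    hs.of_dvd hPm (Polynomial.map_dvd _ radical_dvd_self)
  have hsep : (radical P).Separable := PerfectField.separable_iff_squarefree.mpr squarefree_radical
  have hnd : ((radical P).map (algebraMap ℚ ℝ)).roots.Nodup := nodup_roots hsep.map
  have hSr : ((radical P).map (algebraMap ℚ ℝ)).roots = S.val := by
    rw [Multiset.Nodup.ext hnd S.nodup]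
    intro x
    rw [mem_roots (Polynomial.map_ne_zero hR0), Finset.mem_val, hS, IsRoot.def, eval_map_algebraMap]
    constructor
    · intro h
      obtain ⟨c, hc⟩ := radical_dvd_self (a := P)
      rw [hc, map_mul, h, zero_mul]
    · intro h
      obtain ⟨n, c, hc⟩ := exists_dvd_radical_self_pow hP
      have := congrArg (aeval x) hc
      rw [map_pow, map_mul, h, zero_mul] at this
      by_contra hne
      exact pow_ne_zero n hne this
  refine ⟨C (radical P).leadingCoeff⁻¹ * radical P, ?_⟩
  have h1 := hRs.eq_prod_roots
  rw [hSr] at h1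
  rw [Polynomial.map_mul, h1, map_C, ← mul_assoc, ← C_mul, leadingCoeff_map, ← map_mul,
    inv_mul_cancel₀ (leadingCoeff_ne_zero.mpr hR0)]
  rw [map_one, C_1, one_mul]
  rfl

theorem exists_int_of_isIntegral {x : ℝ} (hx : IsIntegral ℤ x) {q : ℚ} (h : x = q) :
    ∃ n : ℤ, x = n := by
  have : IsIntegral ℤ q := by
    rw [← isIntegral_algebraMap_iff (algebraMap ℚ ℝ).injective]
    simpa [← h] using hx
  obtain ⟨n, rfl⟩ := IsIntegrallyClosed.isIntegral_iff.mp this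
  exact ⟨n, by simpa using h⟩

end Spectrum

/-! ### Adjacency spectra and regularity -/

section Graph

variable {V : Type*} [Fintype V] [DecidableEq V] {G : SimpleGraph V} [DecidableRel G.Adj]

omit [Fintype V] [DecidableEq V] in
theorem isHermitian_adjMatrix : (G.adjMatrix ℝ).IsHermitian := by
  rw [Matrix.IsHermitian, Matrix.conjTranspose_eq_transpose_of_trivial, G.transpose_adjMatrix]

omit [DecidableEq V] in
theorem trace_adjMatrix_mul_self {D : ℕ} (hreg : G.IsRegularOfDegree D) :
    (G.adjMatrix ℝ * G.adjMatrix ℝ).trace = D * Fintype.card V := by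
  rw [Matrix.trace]
  simp only [Matrix.diag_apply, SimpleGraph.adjMatrix_mul_self_apply_self, hreg.degree_eq,
    Finset.sum_const, Finset.card_univ, nsmul_eq_mul]
  exact mul_comm _ _

omit [DecidableEq V] in
theorem sum_mulVec_adjMatrix {D : ℕ} (hreg : G.IsRegularOfDegree D) (v : V → ℝ) :
    ∑ x, (G.adjMatrix ℝ *ᵥ v) x = D * ∑ x, v x := by
  simp only [Matrix.mulVec, dotProduct]
  rw [Finset.sum_comm, Finset.mul_sum]
  refine Finset.sum_congr rfl fun y _ => ?_
  rw [← Finset.sum_mul]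
  congr 1
  have := hreg.degree_eq y
  simp only [SimpleGraph.adjMatrix_apply, Finset.sum_boole]
  rw [← this, ← SimpleGraph.card_neighborFinset_eq_degree]
  congr 2
  ext z
  simp [G.adj_comm]

theorem abs_le_of_mem_spectrum {D : ℕ} (hreg : G.IsRegularOfDegree D) {t : ℝ}
    (ht : t ∈ spectrum ℝ (G.adjMatrix ℝ)) : |t| ≤ D := by
  obtain ⟨v, hv, h⟩ := exists_eigenvector isHermitian_adjMatrix ht
  obtain ⟨y, hy⟩ := Function.ne_iff.mp hv
  obtain ⟨x, -, hx⟩ := Finset.exists_max_image Finset.univ (fun x => |v x|) ⟨y, Finset.mem_univ y⟩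
  have hpos : 0 < |v x| := (abs_pos.mpr hy).trans_le (hx y (Finset.mem_univ y))
  have h1 := congrFun h x
  rw [SimpleGraph.adjMatrix_mulVec_apply, Pi.smul_apply, smul_eq_mul] at h1
  have h2 : |t| * |v x| ≤ D * |v x| := by
    rw [← abs_mul, ← h1]
    refine (Finset.abs_sum_le_sum_abs _ _).trans ?_
    refine (Finset.sum_le_card_nsmul _ _ _ fun z _ => hx z (Finset.mem_univ z)).trans ?_
    rw [SimpleGraph.card_neighborFinset_eq_degree, hreg.degree_eq, nsmul_eq_mul]
  exact le_of_mul_le_mul_right h2 hpos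

theorem degree_mem_spectrum [Nonempty V] {D : ℕ} (hreg : G.IsRegularOfDegree D) :
    (D : ℝ) ∈ spectrum ℝ (G.adjMatrix ℝ) := by
  refine mem_spectrum_of_eigenvector (v := Function.const V 1) ?_ ?_
  · intro h
    exact one_ne_zero (congrFun h (Classical.arbitrary V))
  · funext x
    simpa using hreg.degree_eq x

/-- With `c ≠ 0`, `J` is a polynomial in `A` and so commutes with it; the entries of `A J` and `J A`
are the degrees of the row and column vertices. -/
theorem exists_regular_of_pow_eq {ℓ : ℕ} {a b c : ℝ} (hc : c ≠ 0)
    (h : G.adjMatrix ℝ ^ ℓ =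
      a • (1 : Matrix V V ℝ) + b • G.adjMatrix ℝ + c • Matrix.of fun _ _ => (1 : ℝ)) :
    ∃ D : ℕ, G.IsRegularOfDegree D := by
  set A := G.adjMatrix ℝ with hA
  set J : Matrix V V ℝ := Matrix.of fun _ _ => (1 : ℝ) with hJ
  have hcomm : A * J = J * A := by
    have hJe : J = c⁻¹ • (A ^ ℓ - a • (1 : Matrix V V ℝ) - b • A) := by
      rw [h]
      have : a • (1 : Matrix V V ℝ) + b • A + c • J - a • (1 : Matrix V V ℝ) - b • A = c • J := by
        abel
      rw [this, smul_smul, inv_mul_cancel₀ hc, one_smul]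
    rw [hJe]
    simp [mul_sub, sub_mul, ← pow_succ, ← pow_succ']
  have hdeg : ∀ x y, G.degree x = G.degree y := by
    intro x y
    have h1 := congrFun (congrFun hcomm x) y
    rw [hA, SimpleGraph.adjMatrix_mul_apply, SimpleGraph.mul_adjMatrix_apply] at h1
    simp [hJ] at h1
    exact h1
  rcases isEmpty_or_nonempty V with hV | ⟨⟨x⟩⟩
  · exact ⟨0, fun y => hV.elim y⟩
  · exact ⟨G.degree x, fun y => hdeg y x⟩

/-- In the regular case an eigenvector for `t ≠ D` has entry sum zero, so `J` kills it. -/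
theorem pow_eigenvalue_eq {ℓ : ℕ} {a b c : ℝ}
    (h : G.adjMatrix ℝ ^ ℓ =
      a • (1 : Matrix V V ℝ) + b • G.adjMatrix ℝ + c • Matrix.of fun _ _ => (1 : ℝ))
    {t : ℝ} (ht : t ∈ spectrum ℝ (G.adjMatrix ℝ)) (hc : c = 0 ∨ ∃ D : ℕ, G.IsRegularOfDegree D ∧ t ≠ D) :
    t ^ ℓ = b * t + a := by
  obtain ⟨v, hv, hvt⟩ := exists_eigenvector isHermitian_adjMatrix ht
  have hJ : c • ((Matrix.of fun _ _ => (1 : ℝ) : Matrix V V ℝ) *ᵥ v) = 0 := by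
    rcases hc with rfl | ⟨D, hreg, hc⟩
    · rw [zero_smul]
    · have h1 := sum_mulVec_adjMatrix hreg v
      rw [hvt] at h1
      simp only [Pi.smul_apply, smul_eq_mul, ← Finset.mul_sum] at h1
      have h2 : ∑ x, v x = 0 := by
        by_contra hne
        exact hc (mul_right_cancel₀ hne h1)
      have : (Matrix.of fun _ _ => (1 : ℝ) : Matrix V V ℝ) *ᵥ v = 0 := by
        funext x
        simpa [Matrix.mulVec, dotProduct] using h2
      rw [this, smul_zero]
  have h3 := pow_mulVec_eigenvector hvt ℓ
  rw [h, Matrix.add_mulVec, Matrix.add_mulVec, Matrix.smul_mulVec, Matrix.smul_mulVec,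
    Matrix.smul_mulVec, hJ, hvt, Matrix.one_mulVec, add_zero, smul_smul, ← add_smul] at h3
  have := smul_left_injective ℝ hv h3
  linarith

end Graph

/-! ### Periodicity and the four eigenvalues -/

section Main

variable {V : Type*} [Fintype V] [DecidableEq V] {G : SimpleGraph V} [DecidableRel G.Adj]

-- The monic polynomial with the four eigenvalues as simple roots is rational, by passing to the
-- radical of the rational characteristic polynomial. Since `D` is rational, its contribution can be
-- removed from the coefficients.
open Polynomial in
theorem exists_rational_symmetric_functions {D : ℕ} {θ₁ θ₂ θ₃ : ℝ} (h₁ : θ₁ < D) (h₂ : θ₂ < θ₁)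
    (h₃ : θ₃ < θ₂) (hspec : spectrum ℝ (G.adjMatrix ℝ) = {(D : ℝ), θ₁, θ₂, θ₃}) :
    ∃ s₁ s₂ s₃ : ℚ, θ₁ + θ₂ + θ₃ = s₁ ∧ θ₁ * θ₂ + θ₁ * θ₃ + θ₂ * θ₃ = s₂ ∧ θ₁ * θ₂ * θ₃ = s₃ := by
  have hmap : (G.adjMatrix ℚ).charpoly.map (algebraMap ℚ ℝ) = (G.adjMatrix ℝ).charpoly := by
    rw [← Matrix.charpoly_map]
    congr 1
    ext x y
    simp [SimpleGraph.adjMatrix_apply, apply_ite]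
  obtain ⟨Q, hQ⟩ := exists_rational_prod_roots (P := (G.adjMatrix ℚ).charpoly)
    (S := {(D : ℝ), θ₁, θ₂, θ₃}) (Matrix.charpoly_monic _).ne_zero
    (by rw [hmap]; exact isHermitian_adjMatrix.splits_charpoly) (by
      intro x
      rw [← eval_map_algebraMap, hmap, ← IsRoot.def, ← Matrix.mem_spectrum_iff_isRoot_charpoly,
        hspec]
      simp)
  rw [Finset.prod_insert (by simp; refine ⟨?_, ?_, ?_⟩ <;> intro h <;> linarith),
    Finset.prod_insert (by simp; refine ⟨?_, ?_⟩ <;> intro h <;> linarith),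
    Finset.prod_insert (by simp; intro h; linarith), Finset.prod_singleton] at hQ
  have hQ' : Q.map (algebraMap ℚ ℝ) = X ^ 4 - C (D + (θ₁ + θ₂ + θ₃)) * X ^ 3
      + C (D * (θ₁ + θ₂ + θ₃) + (θ₁ * θ₂ + θ₁ * θ₃ + θ₂ * θ₃)) * X ^ 2
      - C (D * (θ₁ * θ₂ + θ₁ * θ₃ + θ₂ * θ₃) + θ₁ * θ₂ * θ₃) * X + C (D * (θ₁ * θ₂ * θ₃)) := by
    rw [hQ]
    simp only [C_add, C_mul]
    ring
  have c3 := congrArg (fun p => coeff p 3) hQ'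
  have c2 := congrArg (fun p => coeff p 2) hQ'
  have c1 := congrArg (fun p => coeff p 1) hQ'
  simp only [coeff_map, coeff_add, coeff_sub, coeff_C_mul, coeff_X_pow, coeff_X, coeff_C,
    eq_ratCast] at c1 c2 c3
  norm_num at c1 c2 c3
  have e1 : θ₁ + θ₂ + θ₃ = ((-Q.coeff 3 - D : ℚ) : ℝ) := by push_cast; linarith
  have e2 : θ₁ * θ₂ + θ₁ * θ₃ + θ₂ * θ₃ =
      ((Q.coeff 2 - D * (-Q.coeff 3 - D) : ℚ) : ℝ) := by
    rw [e1] at c2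
    push_cast at c2 ⊢
    linarith
  refine ⟨_, _, -Q.coeff 1 - D * (Q.coeff 2 - D * (-Q.coeff 3 - D)), e1, e2, ?_⟩
  rw [e2] at c1
  push_cast at c1 ⊢
  linarith

theorem isIntegral_eigenvalue {D : ℕ} (hreg : G.IsRegularOfDegree D) (hD : 0 < D)
    (hper : IsPeriodic G) {t : ℝ} (ht : t ∈ spectrum ℝ (G.adjMatrix ℝ)) :
    IsIntegral ℤ (2 * (t / D)) := by
  obtain ⟨v, hv, h⟩ := exists_eigenvector isHermitian_adjMatrix ht
  have h1 := isIntegral_of_periodic hreg hD hper (μ := ((t / D : ℝ) : ℂ))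
    (v := fun x => (v x : ℂ)) (fun h0 => hv (funext fun x => by simpa using congrFun h0 x)) (by
      funext x
      have h2 := congrFun h x
      rw [SimpleGraph.adjMatrix_mulVec_apply, Pi.smul_apply, smul_eq_mul] at h2
      rw [Matrix.smul_mulVec, Pi.smul_apply, Pi.smul_apply, SimpleGraph.adjMatrix_mulVec_apply,
        ← Complex.ofReal_sum, h2, smul_eq_mul, smul_eq_mul]
      push_cast
      ring)
  rw [← isIntegral_algebraMap_iff (algebraMap ℝ ℂ).injective]
  simpa using h1

theorem sum_eigenvalues_eq {D : ℝ} {θ₁ θ₂ θ₃ : ℝ} (h₁ : θ₁ < D) (h₂ : θ₂ < θ₁)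
    (h₃ : θ₃ < θ₂) (hspec : spectrum ℝ (G.adjMatrix ℝ) = {D, θ₁, θ₂, θ₃}) :
    ∃ m₀ m₁ m₂ m₃ : ℕ, 0 < m₀ ∧ 0 < m₁ ∧ 0 < m₂ ∧ 0 < m₃ ∧ ∀ f : ℝ → ℝ,
      ∑ i, f ((isHermitian_adjMatrix (G := G)).eigenvalues i) =
        m₀ * f D + m₁ * f θ₁ + m₂ * f θ₂ + m₃ * f θ₃ := by
  set e := (isHermitian_adjMatrix (G := G)).eigenvalues with he
  have hr : Set.range e = {D, θ₁, θ₂, θ₃} := by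
    rw [he, ← Matrix.IsHermitian.spectrum_real_eq_range_eigenvalues, hspec]
  have himg : Finset.univ.image e = {D, θ₁, θ₂, θ₃} := by
    rw [← Finset.coe_inj, Finset.coe_image, Finset.coe_univ, Set.image_univ, hr]
    simp
  have hpos : ∀ t ∈ ({D, θ₁, θ₂, θ₃} : Set ℝ), 0 < (Finset.univ.filter fun i => e i = t).card := by
    intro t ht
    rw [← hr] at ht
    obtain ⟨i, hi⟩ := ht
    exact Finset.card_pos.mpr ⟨i, by simpa using hi⟩
  refine ⟨_, _, _, _, hpos D (by simp), hpos θ₁ (by simp), hpos θ₂ (by simp), hpos θ₃ (by simp),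
    fun f => ?_⟩
  rw [Finset.sum_comp f e, himg,
    Finset.sum_insert (by simp; refine ⟨?_, ?_, ?_⟩ <;> intro h <;> linarith),
    Finset.sum_insert (by simp; refine ⟨?_, ?_⟩ <;> intro h <;> linarith),
    Finset.sum_insert (by simp; intro h; linarith), Finset.sum_singleton]
  simp only [nsmul_eq_mul]
  ring

/-- A genuine strongly walk-regular graph is regular, and the three smaller eigenvalues are roots of
a trinomial. -/
theorem IsGenuineStronglyWalkRegular.exists_regular (hG : IsGenuineStronglyWalkRegular G)
    {k θ₁ θ₂ θ₃ : ℝ} (h₁ : θ₁ < k) (h₂ : θ₂ < θ₁) (h₃ : θ₃ < θ₂)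
    (hspec : spectrum ℝ (G.adjMatrix ℝ) = {k, θ₁, θ₂, θ₃}) :
    ∃ D : ℕ, 0 < D ∧ k = D ∧ G.IsRegularOfDegree D ∧ ∃ (ℓ : ℕ) (a b : ℝ), 2 ≤ ℓ ∧
      θ₁ ^ ℓ = b * θ₁ + a ∧ θ₂ ^ ℓ = b * θ₂ + a ∧ θ₃ ^ ℓ = b * θ₃ + a := by
  obtain ⟨ℓ, hℓ, a, b, c, h⟩ := hG.stronglyWalkRegular
  have := hG.connected.nonempty
  have mk : k ∈ spectrum ℝ (G.adjMatrix ℝ) := by simp [hspec]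
  have m₁ : θ₁ ∈ spectrum ℝ (G.adjMatrix ℝ) := by simp [hspec]
  have m₂ : θ₂ ∈ spectrum ℝ (G.adjMatrix ℝ) := by simp [hspec]
  have m₃ : θ₃ ∈ spectrum ℝ (G.adjMatrix ℝ) := by simp [hspec]
  -- Without the `J` term all four eigenvalues would be roots of one trinomial.
  have hc : c ≠ 0 := fun hc =>
    not_four_roots hℓ (pow_eigenvalue_eq h mk (.inl hc)) (pow_eigenvalue_eq h m₁ (.inl hc))
      (pow_eigenvalue_eq h m₂ (.inl hc)) (pow_eigenvalue_eq h m₃ (.inl hc)) h₁ h₂ h₃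
  obtain ⟨D, hreg⟩ := exists_regular_of_pow_eq hc h
  have hkD : k = D := by
    refine le_antisymm ((le_abs_self k).trans (abs_le_of_mem_spectrum hreg mk)) ?_
    have := degree_mem_spectrum hreg
    rw [hspec] at this
    simp only [Set.mem_insert_iff, Set.mem_singleton_iff] at this
    rcases this with h | h | h | h <;> linarith
  have hD : (0 : ℝ) < D := by
    have := (abs_le.mp (abs_le_of_mem_spectrum hreg m₃)).1
    linarith
  exact ⟨D, by exact_mod_cast hD, hkD, hreg, ℓ, a, b, hℓ,
    pow_eigenvalue_eq h m₁ (.inr ⟨D, hreg, by linarith⟩),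
    pow_eigenvalue_eq h m₂ (.inr ⟨D, hreg, by linarith⟩),
    pow_eigenvalue_eq h m₃ (.inr ⟨D, hreg, by linarith⟩)⟩

theorem scaled_pow_eq {ℓ : ℕ} (hℓ : 2 ≤ ℓ) {a b t s : ℝ} (h : t ^ ℓ = b * t + a) :
    (s * t) ^ ℓ = (s ^ (ℓ - 1) * b) * (s * t) + s ^ ℓ * a := by
  obtain ⟨m, rfl⟩ : ∃ m, ℓ = m + 1 := ⟨ℓ - 1, by omega⟩
  rw [mul_pow, h, Nat.add_sub_cancel]
  ring

theorem eigenvalues_of_periodic {D : ℕ} (hreg : G.IsRegularOfDegree D) (hD : 0 < D)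
    {θ₁ θ₂ θ₃ : ℝ} (h₁ : θ₁ < D) (h₂ : θ₂ < θ₁) (h₃ : θ₃ < θ₂)
    (hspec : spectrum ℝ (G.adjMatrix ℝ) = {(D : ℝ), θ₁, θ₂, θ₃}) {ℓ : ℕ} {a b : ℝ} (hℓ : 2 ≤ ℓ)
    (p₁ : θ₁ ^ ℓ = b * θ₁ + a) (p₂ : θ₂ ^ ℓ = b * θ₂ + a) (p₃ : θ₃ ^ ℓ = b * θ₃ + a)
    (hper : IsPeriodic G) : θ₁ = D / 2 ∧ θ₂ = 0 ∧ θ₃ = -(D / 2) := by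
  have hD' : (0 : ℝ) < D := by exact_mod_cast hD
  -- Scaling by `2 / D` makes the eigenvalues algebraic integers and sends `D` to 2.
  obtain ⟨s, hs⟩ : ∃ s : ℝ, s = 2 / D := ⟨_, rfl⟩
  have hs0 : 0 < s := by rw [hs]; positivity
  have hsD : s * D = 2 := by rw [hs]; field_simp
  have hint : ∀ t ∈ spectrum ℝ (G.adjMatrix ℝ), IsIntegral ℤ (s * t) := by
    intro t ht
    have := isIntegral_eigenvalue hreg hD hper ht
    rwa [show 2 * (t / D) = s * t by rw [hs]; ring] at this
  have i₁ := hint θ₁ (by simp [hspec])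
  have i₂ := hint θ₂ (by simp [hspec])
  have i₃ := hint θ₃ (by simp [hspec])
  obtain ⟨r₁, r₂, r₃, e₁, e₂, e₃⟩ := exists_rational_symmetric_functions h₁ h₂ h₃ hspec
  obtain ⟨p, hp⟩ := exists_int_of_isIntegral ((i₁.add i₂).add i₃) (q := 2 / D * r₁) (by
    push_cast; rw [← e₁, hs]; ring)
  obtain ⟨q, hq⟩ := exists_int_of_isIntegral (((i₁.mul i₂).add (i₁.mul i₃)).add (i₂.mul i₃))
    (q := (2 / D) ^ 2 * r₂) (by push_cast; rw [← e₂, hs]; ring)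
  obtain ⟨r, hr⟩ := exists_int_of_isIntegral ((i₁.mul i₂).mul i₃) (q := (2 / D) ^ 3 * r₃) (by
    push_cast; rw [← e₃, hs]; ring)
  have l12 : s * θ₂ < s * θ₁ := mul_lt_mul_of_pos_left h₂ hs0
  have l23 : s * θ₃ < s * θ₂ := mul_lt_mul_of_pos_left h₃ hs0
  have l1 : s * θ₁ < 2 := by rw [← hsD]; exact mul_lt_mul_of_pos_left h₁ hs0
  have l3 : -2 ≤ s * θ₃ := by
    have h0 := (abs_le.mp (abs_le_of_mem_spectrum hreg (t := θ₃) (by simp [hspec]))).1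
    have := mul_le_mul_of_nonneg_left h0 hs0.le
    linarith
  have hp0 := sum_eq_zero_of_roots hℓ (scaled_pow_eq hℓ p₁ (s := s)) (scaled_pow_eq hℓ p₂)
    (scaled_pow_eq hℓ p₃) l12 l23 l1.le l3 hp hq hr
  rw [hp0, Int.cast_zero] at hp
  obtain ⟨m₀, m₁, m₂, m₃, g₀, g₁, g₂, g₃, hsum⟩ := sum_eigenvalues_eq h₁ h₂ h₃ hspec
  have t₁ := hsum id
  have t₂ := hsum (· ^ 2)
  have t₀ := hsum fun _ => 1
  have tr := (isHermitian_adjMatrix (G := G)).trace_eq_sum_eigenvalues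
  rw [SimpleGraph.trace_adjMatrix] at tr
  simp only [RCLike.ofReal_real_eq_id, id_eq] at tr t₁
  rw [← tr] at t₁
  rw [← trace_sq_eq_sum_eigenvalues, trace_adjMatrix_mul_self hreg] at t₂
  simp only [Finset.sum_const, Finset.card_univ, nsmul_eq_mul, mul_one] at t₀
  rw [t₀] at t₂
  obtain ⟨f₁, f₂, f₃⟩ := cubic_coeffs_of_traces l12 l23 l1 l3 hp (q := -q)
    (by push_cast; linarith) hr hD g₀ g₁ g₂ g₃ (by linear_combination -s * t₁ - m₀ * hsD) (by
      have : (4 : ℝ) = s ^ 2 * D ^ 2 := by rw [← mul_pow, hsD]; norm_num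
      rw [this]
      linear_combination -D * s ^ 2 * t₂)
  have inj : ∀ t u : ℝ, s * t = s * u → t = u := fun t u h => mul_left_cancel₀ hs0.ne' h
  exact ⟨inj _ _ (by rw [f₁]; linarith), inj _ _ (by rw [f₂]; ring), inj _ _ (by rw [f₃]; linarith)⟩

open Polynomial in
theorem timeEvolution_pow_twelve_of_spectrum {D : ℕ} (hreg : G.IsRegularOfDegree D) (hD : 0 < D)
    (hspec : spectrum ℝ (G.adjMatrix ℝ) = {(D : ℝ), (D : ℝ) / 2, 0, -((D : ℝ) / 2)}) :
    timeEvolution G ^ 12 = 1 := by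
  have hD' : (D : ℝ) ≠ 0 := by exact_mod_cast hD.ne'
  set M : Matrix V V ℝ := (D : ℝ)⁻¹ • G.adjMatrix ℝ with hM
  have hpoly : M ^ 4 - M ^ 3 - (1 / 4 : ℝ) • M ^ 2 + (1 / 4 : ℝ) • M = 0 := by
    have h := aeval_eq_zero_of_spectrum (isHermitian_adjMatrix (G := G))
      (C ((D : ℝ)⁻¹ ^ 4) * X ^ 4 - C ((D : ℝ)⁻¹ ^ 3) * X ^ 3 - C (1 / 4 * (D : ℝ)⁻¹ ^ 2) * X ^ 2
        + C (1 / 4 * (D : ℝ)⁻¹) * X) (by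
          rw [hspec]
          rintro t (rfl | rfl | rfl | rfl) <;>
            simp only [eval_add, eval_sub, eval_mul, eval_C, eval_pow, eval_X] <;>
            field_simp <;> norm_num)
    simp only [map_add, map_sub, map_mul (aeval (R := ℝ) _), aeval_C, map_pow (aeval (R := ℝ) _),
      aeval_X, ← Algebra.smul_def] at h
    simpa only [hM, _root_.smul_pow, smul_smul] using h
  refine timeEvolution_pow_twelve hreg hD (T := M.map Complex.ofRealHom) ?_ ?_
  · ext x y
    by_cases h : G.Adj x y <;> simp [hM, SimpleGraph.adjMatrix_apply, h]
  · have h := congrArg Complex.ofRealHom.mapMatrix hpoly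
    have hs : ∀ N : Matrix V V ℝ, Complex.ofRealHom.mapMatrix ((1 / 4 : ℝ) • N) =
        (1 / 4 : ℂ) • Complex.ofRealHom.mapMatrix N := by
      intro N
      ext x y
      simp
    simpa only [map_add, map_sub, map_pow, hs, map_zero, RingHom.mapMatrix_apply] using h

end Main

end GroverWalk

/-- Here `k > θ₁ > θ₂ > θ₃` are the distinct eigenvalues of the adjacency matrix of `G`. -/
theorem mainTheorem5 {V : Type*} [Fintype V] [DecidableEq V]
    (G : SimpleGraph V) [DecidableRel G.Adj]
    (hG : GroverWalk.IsGenuineStronglyWalkRegular G)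
    (k θ₁ θ₂ θ₃ : ℝ) (h₁ : θ₁ < k) (h₂ : θ₂ < θ₁) (h₃ : θ₃ < θ₂)
    (hspec : spectrum ℝ (G.adjMatrix ℝ) = {k, θ₁, θ₂, θ₃}) :
    (GroverWalk.IsPeriodic G ↔ (θ₁, θ₂, θ₃) = (k / 2, 0, -(k / 2))) ∧
      ((θ₁, θ₂, θ₃) = (k / 2, 0, -(k / 2)) → GroverWalk.timeEvolution G ^ 12 = 1) := by
  obtain ⟨D, hD, rfl, hreg, ℓ, a, b, hℓ, p₁, p₂, p₃⟩ := hG.exists_regular h₁ h₂ h₃ hspec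
  have hrev : (θ₁, θ₂, θ₃) = ((D : ℝ) / 2, (0 : ℝ), -((D : ℝ) / 2)) →
      GroverWalk.timeEvolution G ^ 12 = 1 := by
    intro h
    simp only [Prod.mk.injEq] at h
    obtain ⟨rfl, rfl, rfl⟩ := h
    exact GroverWalk.timeEvolution_pow_twelve_of_spectrum hreg hD hspec
  refine ⟨⟨fun hper => ?_, fun h => ⟨12, by norm_num, hrev h⟩⟩, hrev⟩
  obtain ⟨e₁, e₂, e₃⟩ :=
    GroverWalk.eigenvalues_of_periodic hreg hD h₁ h₂ h₃ hspec hℓ p₁ p₂ p₃ hper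
  rw [e₁, e₂, e₃]
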